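/- Let $n \ge 0$ and let $G = G_0 * G_1 * \cdots * G_n$, where each $G_i = \langle x_i\rangle$ is a group of order two. Let $\mathrm{Aut}(G, x_0)$ be the group of all automorphisms $\phi$ of $G$ with $\phi(x_0) = x_0$. Let $\mathrm{FR}(G)$ be the Fouxe-Rabinovitch group, i.e. the subgroup of $\mathrm{Aut}(G)$ generated by the automorphisms $\alpha_j^{g}$ with $1 \ne g \in G_i$ and $i \ne j$, where $\alpha_j^{g}$ conjugates every element of $G_j$ by $g$ and fixes every element of $G_k$ for $k \neq j$; put $\mathrm{FR}(G, x_0) = \mathrm{FR}(G) \cap \mathrm{Aut}(G, x_0)$. For a free group $F_n = F(a_1, \ldots, a_n)$, a palindrome is an element whose reduced word in the letters $a_i^{\pm 1}$ equals its reverse. Let $\Pi A(F_n)$ be the group of all automorphisms of $F_n$ that send each generator $a_i$ to a palindrome. Let $P\Pi A(F_n)$ be the subgroup of $\Pi A(F_n)$ generated by the palindromic Whitehead moves $(a_i \,\|\, a_j)$, $i \ne j$, which send $a_i \mapsto a_j a_i a_j$ and fix all other generators, and the factor automorphisms, which send $a_i \mapsto a_i^{-1}$ and fix all other generators. Lemma.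 The subgroup of $G$ consisting of all products of an even number of the letters $x_0, \ldots, x_n$ is free on $a_i = x_0 x_i$, $1 \le i \le n$; denote it by $F_n$. Restriction of automorphisms to $F_n$ gives an isomorphism $\iota : \mathrm{Aut}(G, x_0) \to \Pi A(F_n)$ (palindromes being taken with respect to $a_1, \ldots, a_n$), and $\iota(\mathrm{FR}(G, x_0)) = P\Pi A(F_n)$. -/

import Mathlib

namespace PalindromicAut

/-! ### Fouxe-Rabinovitch automorphisms of a free product -/

section FreeProduct

variable {ι : Type*} [DecidableEq ι] {H : ι → Type*} [∀ i, Group (H i)]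

/-- The endomorphism of a free product that conjugates every element of the factor `H j`
by the element `g` and is the identity on every other factor. -/
def partialConjHom (j : ι) {i : ι} (g : H i) : Monoid.CoprodI H →* Monoid.CoprodI H :=
  Monoid.CoprodI.lift fun k =>
    if k = j then (MulAut.conj (Monoid.CoprodI.of g)).toMonoidHom.comp Monoid.CoprodI.of
    else Monoid.CoprodI.of

theorem partialConjHom_of (j : ι) {i : ι} (g : H i) (k : ι) (h : H k) :
    partialConjHom j g (Monoid.CoprodI.of h) =
      if k = j then Monoid.CoprodI.of g * Monoid.CoprodI.of h * (Monoid.CoprodI.of g)⁻¹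
      else Monoid.CoprodI.of h := by
  unfold partialConjHom
  rw [Monoid.CoprodI.lift_of]
  split_ifs <;> simp

theorem partialConjHom_comp (j : ι) {i : ι} (g : H i) :
    (partialConjHom j g).comp (partialConjHom j g⁻¹) = MonoidHom.id _ := by
  refine Monoid.CoprodI.ext_hom _ _ fun k => MonoidHom.ext fun h => ?_
  simp only [MonoidHom.comp_apply, MonoidHom.id_apply]
  rw [partialConjHom_of]
  by_cases hk : k = j
  · have hg : partialConjHom j g (Monoid.CoprodI.of g) = Monoid.CoprodI.of g := by
      rw [partialConjHom_of]; split_ifs <;> simp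
    simp only [if_pos hk, map_mul, map_inv, hg]
    rw [partialConjHom_of, if_pos hk]
    group
  · rw [if_neg hk, partialConjHom_of, if_neg hk]

/-- The automorphism `α_j^g` of a free product, for an element `g` of the factor `H i`: it
conjugates every element of the factor `H j` by `g` and fixes every other factor pointwise. -/
def partialConj (j : ι) {i : ι} (g : H i) : MulAut (Monoid.CoprodI H) :=
  MonoidHom.toMulEquiv (partialConjHom j g) (partialConjHom j g⁻¹)
    (by simpa using partialConjHom_comp j g⁻¹) (partialConjHom_comp j g)

variable (H) in
/-- The Fouxe-Rabinovitch group of a free product: the subgroup of its automorphism group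
generated by the `α_j^g` with `1 ≠ g ∈ H i` and `i ≠ j`. -/
def fouxeRabinovitch : Subgroup (MulAut (Monoid.CoprodI H)) :=
  Subgroup.closure {φ | ∃ (i j : ι) (g : H i), i ≠ j ∧ g ≠ 1 ∧ φ = partialConj j g}

end FreeProduct

/-! ### The free product of `n + 1` groups of order two -/

/-- The free product of `n + 1` copies (numbered `0, …, n`) of the group with two elements. -/
abbrev FreeProdZ2 (n : ℕ) : Type :=
  Monoid.CoprodI fun _ : Fin (n + 1) => Multiplicative (ZMod 2)

/-- The generator `x_i` of the `i`-th factor. -/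
def x {n : ℕ} (i : Fin (n + 1)) : FreeProdZ2 n :=
  Monoid.CoprodI.of (M := fun _ : Fin (n + 1) => Multiplicative (ZMod 2)) (i := i)
    (Multiplicative.ofAdd 1)

theorem x_mul_self {n : ℕ} (i : Fin (n + 1)) : x i * x i = 1 := by
  unfold x
  rw [← map_mul, ← ofAdd_add]
  exact map_one _

theorem x_inv {n : ℕ} (i : Fin (n + 1)) : (x i)⁻¹ = x i :=
  inv_eq_of_mul_eq_one_right (x_mul_self i)

/-- The subgroup of automorphisms of the free product that fix `x_0`. -/
def autFix (n : ℕ) : Subgroup (MulAut (FreeProdZ2 n)) where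
  carrier := {φ | φ (x 0) = x 0}
  one_mem' := rfl
  mul_mem' {φ ψ} hφ hψ := by
    change φ (ψ (x 0)) = x 0
    rw [show ψ (x 0) = x 0 from hψ]
    exact hφ
  inv_mem' {φ} hφ := by
    change φ.symm (x 0) = x 0
    rw [MulEquiv.symm_apply_eq]
    exact Eq.symm hφ

/-- The subgroup of Fouxe-Rabinovitch automorphisms that fix `x_0`. -/
def fouxeRabinovitchFix (n : ℕ) : Subgroup (MulAut (FreeProdZ2 n)) :=
  fouxeRabinovitch (fun _ : Fin (n + 1) => Multiplicative (ZMod 2)) ⊓ autFix n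

/-- The subgroup of all elements that are products of words of even length in the letters
`x_0, …, x_n`. -/
def evenSubgroup (n : ℕ) : Subgroup (FreeProdZ2 n) where
  carrier := {g | ∃ l : List (Fin (n + 1)), Even l.length ∧ (l.map x).prod = g}
  one_mem' := ⟨[], by simp, by simp⟩
  mul_mem' := by
    rintro _ _ ⟨l, hl, rfl⟩ ⟨m, hm, rfl⟩
    exact ⟨l ++ m, by simpa using hl.add hm, by simp⟩
  inv_mem' := by
    rintro _ ⟨l, hl, rfl⟩
    refine ⟨l.reverse, by simpa using hl, ?_⟩
    have h : (fun g : FreeProdZ2 n => g⁻¹) ∘ x = x := funext x_inv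
    rw [List.prod_inv_reverse, List.map_reverse, List.map_map, h]

/-! ### Palindromic automorphisms of a free group -/

section Palindromic

variable {α : Type*}

/-- An element of a free group is a palindrome if its reduced word (in the generators and their
formal inverses) equals its reverse. -/
def IsPalindrome [DecidableEq α] (w : FreeGroup α) : Prop := w.toWord.Palindrome

/-- The homomorphism to the opposite group that fixes each generator. It reverses words. -/
def rev : FreeGroup α →* (FreeGroup α)ᵐᵒᵖ :=
  FreeGroup.lift fun a => MulOpposite.op (FreeGroup.of a)

theorem rev_mk (L : List (α × Bool)) :
    rev (FreeGroup.mk L) = MulOpposite.op (FreeGroup.mk L.reverse) := by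
  induction L with
  | nil => exact map_one rev
  | cons p L ih =>
    have h1 : (FreeGroup.mk (p :: L)) = FreeGroup.mk [p] * FreeGroup.mk L := by
      rw [FreeGroup.mul_mk]; rfl
    have h2 : FreeGroup.mk (p :: L).reverse = FreeGroup.mk L.reverse * FreeGroup.mk [p] := by
      rw [FreeGroup.mul_mk, List.reverse_cons]
    have h3 : rev (FreeGroup.mk [p]) = MulOpposite.op (FreeGroup.mk [p]) := by
      obtain ⟨a, b⟩ := p
      cases b
      · have : FreeGroup.mk [(a, false)] = (FreeGroup.of a)⁻¹ := rfl
        rw [this, map_inv, rev, FreeGroup.lift_apply_of, MulOpposite.op_inv]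
      · exact FreeGroup.lift_apply_of ..
    rw [h1, map_mul, ih, h3, h2, MulOpposite.op_mul]

variable [DecidableEq α]

theorem isPalindrome_iff (w : FreeGroup α) :
    IsPalindrome w ↔ rev w = MulOpposite.op w := by
  have key : rev w = MulOpposite.op (FreeGroup.mk w.toWord.reverse) := by
    rw [← rev_mk, FreeGroup.mk_toWord]
  unfold IsPalindrome
  rw [List.Palindrome.iff_reverse_eq, key, MulOpposite.op_inj]
  constructor
  · intro h
    rw [h, FreeGroup.mk_toWord]
  · intro h
    have hr : FreeGroup.IsReduced w.toWord.reverse := by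
      have h0 : FreeGroup.IsReduced w.toWord := FreeGroup.isReduced_toWord
      unfold FreeGroup.IsReduced at h0 ⊢
      rw [List.isChain_reverse]
      exact h0.imp fun a b hab e => (hab e.symm).symm
    have := congrArg FreeGroup.toWord h
    rwa [FreeGroup.toWord_mk, hr.reduce_eq] at this

theorem rev_comm_of_palindromic {φ : MulAut (FreeGroup α)}
    (hφ : ∀ a, IsPalindrome (φ (FreeGroup.of a))) (w : FreeGroup α) :
    rev (φ w) = MulOpposite.op (φ (rev w).unop) := by
  have : rev.comp φ.toMonoidHom = (MonoidHom.op φ.toMonoidHom).comp rev := by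
    refine FreeGroup.ext_hom _ _ fun a => ?_
    have := (isPalindrome_iff _).1 (hφ a)
    simpa [rev] using this
  exact DFunLike.congr_fun this w

variable (α) in
/-- The palindromic automorphism group of the free group on `α`: all automorphisms that send
each generator to a palindrome. -/
def palindromicAut : Subgroup (MulAut (FreeGroup α)) where
  carrier := {φ | ∀ a, IsPalindrome (φ (FreeGroup.of a))}
  one_mem' a := (isPalindrome_iff _).2 (FreeGroup.lift_apply_of ..)
  mul_mem' {φ ψ} hφ hψ a := by
    rw [isPalindrome_iff, MulAut.mul_apply, rev_comm_of_palindromic hφ,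
      (isPalindrome_iff _).1 (hψ a), MulOpposite.unop_op]
  inv_mem' {φ} hφ a := by
    rw [isPalindrome_iff]
    have h := rev_comm_of_palindromic hφ (φ⁻¹ (FreeGroup.of a))
    rw [MulAut.apply_inv_self, rev, FreeGroup.lift_apply_of, MulOpposite.op_inj] at h
    have h' := congrArg (φ⁻¹ : MulAut (FreeGroup α)) h
    rw [MulAut.inv_apply_self] at h'
    exact MulOpposite.unop_injective h'.symm

/-- The endomorphism sending the generator `a` to `w` and fixing all other generators. -/
def replaceGen (a : α) (w : FreeGroup α) : FreeGroup α →* FreeGroup α :=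
  FreeGroup.lift fun c => if c = a then w else FreeGroup.of c

/-- The palindromic Whitehead move `(a || b)` for `a ≠ b`: it sends the generator `a` to
`b a b` and fixes all other generators. -/
def whiteheadMove (a b : α) (hab : a ≠ b) : MulAut (FreeGroup α) :=
  MonoidHom.toMulEquiv
    (replaceGen a (FreeGroup.of b * FreeGroup.of a * FreeGroup.of b))
    (replaceGen a ((FreeGroup.of b)⁻¹ * FreeGroup.of a * (FreeGroup.of b)⁻¹))
    (by
      refine FreeGroup.ext_hom _ _ fun c => ?_
      by_cases hc : c = a
      · subst hc; simp [replaceGen, hab.symm, mul_assoc]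
      · simp [replaceGen, hc])
    (by
      refine FreeGroup.ext_hom _ _ fun c => ?_
      by_cases hc : c = a
      · subst hc; simp [replaceGen, hab.symm, mul_assoc]
      · simp [replaceGen, hc])

/-- The factor automorphism: it inverts the generator `a` and fixes all other generators. -/
def factorAut (a : α) : MulAut (FreeGroup α) :=
  MonoidHom.toMulEquiv (replaceGen a (FreeGroup.of a)⁻¹) (replaceGen a (FreeGroup.of a)⁻¹)
    (by
      refine FreeGroup.ext_hom _ _ fun c => ?_
      by_cases hc : c = a
      · subst hc; simp [replaceGen]
      · simp [replaceGen, hc])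
    (by
      refine FreeGroup.ext_hom _ _ fun c => ?_
      by_cases hc : c = a
      · subst hc; simp [replaceGen]
      · simp [replaceGen, hc])

variable (α) in
/-- The pure palindromic automorphism group: generated by all palindromic Whitehead moves and
all factor automorphisms. -/
def purePalindromicAut : Subgroup (MulAut (FreeGroup α)) :=
  Subgroup.closure ({φ | ∃ (a b : α) (hab : a ≠ b), φ = whiteheadMove a b hab} ∪
    {φ | ∃ a : α, φ = factorAut a})

end Palindromic

end PalindromicAut

namespace PalindromicAut

/-! ### Homomorphisms out of a free product of groups of order two -/

/-! Write a_i = x_0 x_i. Conjugation by x_0 inverts every a_i, so on the even subgroup it is the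
automorphism `invGens`, and a word w is a palindrome exactly when `invGens` sends w to w⁻¹
(`isPalindrome_iff_invGens`), that is, when x_0 w squares to 1. An automorphism fixing x_0 preserves
the even subgroup, since free groups are torsion-free and involutions are therefore odd. It commutes
with conjugation by x_0, hence sends each a_i to a palindrome. Conversely a palindromic ψ extends by
x_0 ↦ x_0, x_i ↦ x_0 ψ(a_i), because these images are involutions.

For the Fouxe-Rabinovitch part, conjugating x_i by x_0 restricts to a factor automorphism, and
conjugating x_i by x_j with j ≠ 0 restricts to a factor automorphism times a Whitehead move. It
remains to see that these partial conjugations generate FR(G, x_0). This is a Nielsen-type reduction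
(`mem_of_conjugators`): φ sends each x_i to g_i x_i g_i⁻¹, and the total length of the g_i is
lowered until no word g_j x_j is a prefix of another g_i x_i. A ping-pong argument
(`conjugators_eq_nil`) then uses surjectivity of φ to force every g_i to be empty. -/

theorem eq_one_or_eq_ofAdd_one (z : Multiplicative (ZMod 2)) :
    z = 1 ∨ z = Multiplicative.ofAdd 1 := by
  revert z; decide

theorem ofAdd_one_ne_one : (Multiplicative.ofAdd 1 : Multiplicative (ZMod 2)) ≠ 1 := by
  decide

/-- The homomorphism from the group of order two that sends the generator to an element of
square one. -/
def involutionHom {K : Type*} [Group K] (t : K) (ht : t * t = 1) :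
    Multiplicative (ZMod 2) →* K where
  toFun z := if z = 1 then 1 else t
  map_one' := by simp
  map_mul' a b := by
    have h2 : (Multiplicative.ofAdd 1 * Multiplicative.ofAdd 1 : Multiplicative (ZMod 2)) = 1 := by
      decide
    rcases eq_one_or_eq_ofAdd_one a with rfl | rfl <;>
      rcases eq_one_or_eq_ofAdd_one b with rfl | rfl <;> simp [h2, ht]

/-- The homomorphism from the free product of groups of order two that sends the generators to
given elements of square one. -/
def liftInvolutions {n : ℕ} {K : Type*} [Group K] (t : Fin (n + 1) → K)
    (ht : ∀ i, t i * t i = 1) : FreeProdZ2 n →* K :=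
  Monoid.CoprodI.lift fun i => involutionHom (t i) (ht i)

theorem liftInvolutions_x {n : ℕ} {K : Type*} [Group K] (t : Fin (n + 1) → K)
    (ht : ∀ i, t i * t i = 1) (i : Fin (n + 1)) : liftInvolutions t ht (x i) = t i := by
  unfold liftInvolutions x
  rw [Monoid.CoprodI.lift_of]
  change (if (Multiplicative.ofAdd 1 : Multiplicative (ZMod 2)) = 1 then 1 else t i) = t i
  exact if_neg ofAdd_one_ne_one

theorem hom_ext_x {n : ℕ} {K : Type*} [Monoid K] {f g : FreeProdZ2 n →* K}
    (h : ∀ i, f (x i) = g (x i)) : f = g := by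
  refine Monoid.CoprodI.ext_hom _ _ fun i => MonoidHom.ext fun z => ?_
  rcases eq_one_or_eq_ofAdd_one z with rfl | rfl
  · simp
  · exact h i

theorem mulAut_ext_x {n : ℕ} {φ ψ : MulAut (FreeProdZ2 n)} (h : ∀ i, φ (x i) = ψ (x i)) :
    φ = ψ :=
  MulEquiv.toMonoidHom_injective (hom_ext_x h)

/-! ### Normal forms in a free product of groups of order two -/

section NormalForm

variable {n : ℕ}

/-- The product of the generators indexed by a list. -/
def wordProd (l : List (Fin (n + 1))) : FreeProdZ2 n := (l.map x).prod

@[simp] theorem wordProd_nil : wordProd ([] : List (Fin (n + 1))) = 1 := rfl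

@[simp] theorem wordProd_cons (i : Fin (n + 1)) (l : List (Fin (n + 1))) :
    wordProd (i :: l) = x i * wordProd l := by simp [wordProd]

@[simp] theorem wordProd_append (l m : List (Fin (n + 1))) :
    wordProd (l ++ m) = wordProd l * wordProd m := by simp [wordProd]

/-- A word is reduced if no two consecutive letters are equal. -/
def Reduced (l : List (Fin (n + 1))) : Prop := l.IsChain (· ≠ ·)

/-- Left multiplication by a letter on words, with cancellation. -/
def pushLetter (i : Fin (n + 1)) : List (Fin (n + 1)) → List (Fin (n + 1))
  | [] => [i]
  | j :: l => if i = j then l else i :: j :: l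

theorem Reduced.pushLetter {l : List (Fin (n + 1))} (hl : Reduced l) (i : Fin (n + 1)) :
    Reduced (pushLetter i l) := by
  cases l with
  | nil => simp [PalindromicAut.pushLetter, Reduced]
  | cons j l =>
    change Reduced (if i = j then l else i :: j :: l)
    split_ifs with h
    · exact List.IsChain.tail hl
    · exact List.isChain_cons_cons.2 ⟨h, hl⟩

theorem pushLetter_of_reduced {i : Fin (n + 1)} {l : List (Fin (n + 1))}
    (h : Reduced (i :: l)) : pushLetter i l = i :: l := by
  cases l with
  | nil => rfl
  | cons j l => exact if_neg (List.isChain_cons_cons.1 h).1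

theorem pushLetter_pushLetter {l : List (Fin (n + 1))} (hl : Reduced l) (i : Fin (n + 1)) :
    pushLetter i (pushLetter i l) = l := by
  cases l with
  | nil => simp [pushLetter]
  | cons j l =>
    by_cases h : i = j
    · subst h
      rw [show pushLetter i (i :: l) = l from if_pos rfl]
      exact pushLetter_of_reduced hl
    · rw [show pushLetter i (j :: l) = i :: j :: l from if_neg h]
      exact if_pos rfl

/-- The permutation of the reduced words given by left multiplication by a letter. -/
def pushPerm (i : Fin (n + 1)) : Equiv.Perm {l : List (Fin (n + 1)) // Reduced l} where
  toFun l := ⟨pushLetter i l.1, l.2.pushLetter i⟩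
  invFun l := ⟨pushLetter i l.1, l.2.pushLetter i⟩
  left_inv l := Subtype.ext (pushLetter_pushLetter l.2 i)
  right_inv l := Subtype.ext (pushLetter_pushLetter l.2 i)

/-- The action of the free product on the reduced words. -/
def reducedAction (n : ℕ) : FreeProdZ2 n →* Equiv.Perm {l : List (Fin (n + 1)) // Reduced l} :=
  liftInvolutions pushPerm fun i => Equiv.ext fun l => Subtype.ext (pushLetter_pushLetter l.2 i)

/-- The reduced word of an element. -/
def normalForm (g : FreeProdZ2 n) : List (Fin (n + 1)) :=
  (reducedAction n g ⟨[], List.IsChain.nil⟩).1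

theorem reduced_normalForm (g : FreeProdZ2 n) : Reduced (normalForm g) :=
  (reducedAction n g ⟨[], List.IsChain.nil⟩).2

theorem normalForm_x_mul (i : Fin (n + 1)) (g : FreeProdZ2 n) :
    normalForm (x i * g) = pushLetter i (normalForm g) := by
  unfold normalForm
  rw [map_mul, reducedAction, liftInvolutions_x]
  rfl

/-- Van der Waerden's trick: the word is recovered by letting the element act on the empty reduced
word, so distinct reduced words give distinct elements. -/
theorem normalForm_wordProd {l : List (Fin (n + 1))} (hl : Reduced l) :
    normalForm (wordProd l) = l := by
  induction l with
  | nil => simp [normalForm]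
  | cons i l ih =>
    rw [wordProd_cons, normalForm_x_mul, ih (List.IsChain.tail hl), pushLetter_of_reduced hl]

theorem exists_wordProd_eq (g : FreeProdZ2 n) : ∃ l, wordProd l = g := by
  let S : Subgroup (FreeProdZ2 n) :=
    { carrier := Set.range wordProd
      one_mem' := ⟨[], rfl⟩
      mul_mem' := by
        rintro _ _ ⟨l, rfl⟩ ⟨m, rfl⟩
        exact ⟨l ++ m, wordProd_append l m⟩
      inv_mem' := by
        rintro _ ⟨l, rfl⟩
        induction l with
        | nil => exact ⟨[], by simp⟩
        | cons i l ih =>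
          obtain ⟨m, hm⟩ := ih
          exact ⟨m ++ [i], by simp [hm, x_inv]⟩ }
  -- The lift of the generators into `S`, followed by the inclusion, is the identity; hence `S` is
  -- everything.
  have h := hom_ext_x (n := n)
    (f := S.subtype.comp (liftInvolutions (fun i => ⟨x i, [i], by simp⟩)
      fun i => Subtype.ext (x_mul_self i))) (g := MonoidHom.id _) fun i => by
        rw [MonoidHom.comp_apply, liftInvolutions_x]; rfl
  have h' := DFunLike.congr_fun h g
  rw [MonoidHom.comp_apply, MonoidHom.id_apply] at h'
  exact h' ▸ (liftInvolutions (fun i => (⟨x i, [i], by simp⟩ : S))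
    (fun i => Subtype.ext (x_mul_self i)) g).2

theorem wordProd_pushLetter (i : Fin (n + 1)) (l : List (Fin (n + 1))) :
    wordProd (pushLetter i l) = x i * wordProd l := by
  cases l with
  | nil => rfl
  | cons j l =>
    change wordProd (if i = j then l else i :: j :: l) = _
    split_ifs with h
    · rw [h, wordProd_cons, ← mul_assoc, x_mul_self, one_mul]
    · exact wordProd_cons _ _

theorem wordProd_normalForm (g : FreeProdZ2 n) : wordProd (normalForm g) = g := by
  obtain ⟨l, rfl⟩ := exists_wordProd_eq g
  induction l with
  | nil => simp [normalForm]
  | cons i l ih => rw [wordProd_cons, normalForm_x_mul, wordProd_pushLetter, ih]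

end NormalForm

/-! ### Reduction of automorphisms that conjugate every generator -/

section Reduction

variable {n : ℕ}

theorem partialConj_x (i j k : Fin (n + 1)) :
    partialConj (H := fun _ : Fin (n + 1) => Multiplicative (ZMod 2)) i (i := j)
      (Multiplicative.ofAdd 1) (x k) = if k = i then x j * x k * x j else x k := by
  change partialConjHom (H := fun _ : Fin (n + 1) => Multiplicative (ZMod 2)) i (i := j)
    (Multiplicative.ofAdd 1) (x k) = _
  unfold x
  rw [partialConjHom_of]
  change (if k = i then x j * x k * (x j)⁻¹ else x k) = if k = i then x j * x k * x j else x k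
  rw [x_inv]

/-- The ping-pong step: conjugates of letters move an element into a cone. -/
theorem isPrefix_normalForm_conj_mul {l : List (Fin (n + 1))} {i : Fin (n + 1)}
    (hl : Reduced (l ++ [i])) {w : FreeProdZ2 n} (hw : ¬ l ++ [i] <+: normalForm w) :
    l ++ [i] <+: normalForm (wordProd l * x i * (wordProd l)⁻¹ * w) := by
  set v := (wordProd l)⁻¹ * w with hv
  have hr : ∀ m, Reduced (i :: m) → normalForm (wordProd (l ++ i :: m)) = l ++ i :: m := by
    intro m hm
    refine normalForm_wordProd ?_
    have := List.IsChain.append_overlap (l₁ := l) (l₂ := [i]) (l₃ := m) hl hm (by simp)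
    rwa [List.append_assoc] at this
  -- If v began with the letter i, then the reduced word of w would begin with `l ++ [i]`, against
  -- `hw`.
  have hred : Reduced (i :: normalForm v) := by
    by_contra hc
    have : ∃ m, normalForm v = i :: m := by
      cases hm : normalForm v with
      | nil => exact (hc (by simp [hm, Reduced])).elim
      | cons j m =>
        by_cases h : i = j
        · exact ⟨m, by rw [h]⟩
        · refine (hc ?_).elim
          rw [hm]
          exact List.isChain_cons_cons.2 ⟨h, hm ▸ reduced_normalForm v⟩
    obtain ⟨m, hm⟩ := this
    apply hw
    have hwv : w = wordProd (l ++ i :: m) := by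
      rw [wordProd_append, ← hm, wordProd_normalForm, hv, mul_inv_cancel_left]
    rw [hwv, hr m (hm ▸ reduced_normalForm v)]
    exact ⟨m, by simp⟩
  have : wordProd l * x i * (wordProd l)⁻¹ * w = wordProd (l ++ i :: normalForm v) := by
    rw [wordProd_append, wordProd_cons, wordProd_normalForm, hv]
    group
  rw [this, hr _ hred]
  exact ⟨normalForm v, by simp⟩

/-- If the cones of the images of the generators are pairwise disjoint, then all conjugators
are trivial. -/
theorem conjugators_eq_nil {φ : MulAut (FreeProdZ2 n)} {g : Fin (n + 1) → List (Fin (n + 1))}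
    (hg : ∀ i, φ (x i) = wordProd (g i) * x i * (wordProd (g i))⁻¹)
    (hred : ∀ i, Reduced (g i ++ [i]))
    (hdisj : ∀ i j, i ≠ j → ¬ g j ++ [j] <+: g i ++ [i]) (i : Fin (n + 1)) : g i = [] := by
  -- The first letter of a reduced word determines the cone containing its image. Cones of distinct
  -- letters are disjoint, since two prefixes of one word are comparable.
  have key : ∀ l : List (Fin (n + 1)), ∀ j, Reduced (j :: l) →
      g j ++ [j] <+: normalForm (φ (wordProd (j :: l))) := by
    intro l
    induction l with
    | nil =>
      intro j _
      rw [wordProd_cons, map_mul, hg]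
      apply isPrefix_normalForm_conj_mul (hred j)
      simp [normalForm]
    | cons k l ih =>
      intro j hj
      rw [wordProd_cons, map_mul, hg]
      apply isPrefix_normalForm_conj_mul (hred j)
      intro h
      have h' := ih k (List.IsChain.tail hj)
      have hjk : j ≠ k := (List.isChain_cons_cons.1 hj).1
      rcases List.prefix_or_prefix_of_prefix h h' with h1 | h1
      · exact hdisj _ _ hjk.symm h1
      · exact hdisj _ _ hjk h1
  have hx : normalForm (x i) = [i] := by
    simpa using normalForm_wordProd (l := [i]) (by simp [Reduced])
  -- Surjectivity enters here: if the preimage of `x i` begins with j, then `g j ++ [j]` is a prefix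
  -- of `[i]`.
  have hy : φ (wordProd (normalForm (φ⁻¹ (x i)))) = x i := by
    rw [wordProd_normalForm, MulAut.apply_inv_self]
  cases hm : normalForm (φ⁻¹ (x i)) with
  | nil =>
    rw [hm, wordProd_nil, map_one] at hy
    rw [← hy] at hx
    simp [normalForm] at hx
  | cons j l =>
    have h := key l j (hm ▸ reduced_normalForm _)
    rw [← hm, hy, hx] at h
    have hlen := h.length_le
    have hj : g j = [] := by
      simpa using hlen
    rw [hj] at h
    have : j = i := by simpa using h
    rw [← this, hj]

/-- A cancelling pair inside `l` can be deleted, and a final letter i of `l` commutes with `x i`. -/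
theorem exists_shorter_conjugator {l : List (Fin (n + 1))} {i : Fin (n + 1)}
    (h : ¬ Reduced (l ++ [i])) : ∃ m : List (Fin (n + 1)), m.length < l.length ∧
      wordProd m * x i * (wordProd m)⁻¹ = wordProd l * x i * (wordProd l)⁻¹ := by
  induction l with
  | nil => exact (h (by simp [Reduced])).elim
  | cons j l ih =>
    by_cases hl : Reduced (l ++ [i])
    · cases l with
      | nil =>
        have hji : j = i := by
          by_contra hne
          exact h (by simpa [Reduced] using hne)
        subst hji
        exact ⟨[], by simp, by simp⟩
      | cons k l =>
        have hjk : j = k := by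
          by_contra hne
          exact h (List.isChain_cons_cons.2 ⟨hne, hl⟩)
        subst hjk
        refine ⟨l, by simp, ?_⟩
        rw [wordProd_cons, wordProd_cons, ← mul_assoc, x_mul_self, one_mul]
    · obtain ⟨m, hm, e⟩ := ih hl
      refine ⟨j :: m, by simpa using hm, ?_⟩
      have : ∀ w, wordProd (j :: w) * x i * (wordProd (j :: w))⁻¹ =
          x j * (wordProd w * x i * (wordProd w)⁻¹) * (x j)⁻¹ := by
        intro w
        rw [wordProd_cons]; group
      rw [this, this, e]

/-- An automorphism that fixes the first generator and maps every generator to a conjugate of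
itself is a product of partial conjugations that fix the first generator. -/
theorem mem_of_conjugators (T : Subgroup (MulAut (FreeProdZ2 n)))
    (hT : ∀ i j : Fin (n + 1), i ≠ 0 → i ≠ j →
      partialConj (H := fun _ : Fin (n + 1) => Multiplicative (ZMod 2)) i (i := j)
        (Multiplicative.ofAdd 1) ∈ T) (N : ℕ) :
    ∀ (φ : MulAut (FreeProdZ2 n)) (g : Fin (n + 1) → List (Fin (n + 1))),
      g 0 = [] → ∑ i, (g i).length = N →
      (∀ i, φ (x i) = wordProd (g i) * x i * (wordProd (g i))⁻¹) → φ ∈ T := by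
  induction N using Nat.strong_induction_on with
  | _ N ih =>
  intro φ g h0 hN hg
  -- The induction hypothesis in usable form: one conjugator, not that of `x 0`, gets shorter and
  -- the other images stay the same.
  have step : ∀ (ψ : MulAut (FreeProdZ2 n)) (i : Fin (n + 1)) (m : List (Fin (n + 1))),
      i ≠ 0 → m.length < (g i).length →
      ψ (x i) = wordProd m * x i * (wordProd m)⁻¹ → (∀ k, k ≠ i → ψ (x k) = φ (x k)) →
      ψ ∈ T := by
    intro ψ i m hi hm hψ hk
    refine ih (∑ k, (Function.update g i m k).length) ?_ ψ (Function.update g i m) ?_ rfl ?_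
    · rw [← hN]
      refine Finset.sum_lt_sum (fun k _ => ?_) ⟨i, Finset.mem_univ _, by simpa using hm⟩
      by_cases hki : k = i
      · subst hki; simpa using hm.le
      · simp [hki]
    · rw [Function.update_of_ne hi.symm, h0]
    · intro k
      by_cases hki : k = i
      · subst hki; simpa using hψ
      · rw [hk k hki, Function.update_of_ne hki, hg]
  by_cases hred : ∀ i, Reduced (g i ++ [i])
  · by_cases hdisj : ∀ i j, i ≠ j → ¬ g j ++ [j] <+: g i ++ [i]
    · have : φ = 1 := mulAut_ext_x fun i => by
        rw [hg, conjugators_eq_nil hg hred hdisj]; simp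
      rw [this]
      exact one_mem T
    · push Not at hdisj
      obtain ⟨i, j, hij, hp⟩ := hdisj
      have hp' : g j ++ [j] <+: g i := by
        rcases List.prefix_concat_iff.1 hp with h | h
        · have := congrArg List.getLast? h
          simp at this
          exact (hij this.symm).elim
        · exact h
      obtain ⟨m, hm⟩ := hp'
      have hi : i ≠ 0 := by
        rintro rfl
        rw [h0] at hm
        simp at hm
      have hα := hT i j hi hij
      -- Here g_i = g_j x_j m. The new image of x_i is the conjugate of φ(x_i) by φ(x_j) = g_j x_j
      -- g_j⁻¹, and φ(x_j) g_i = g_j m is one letter shorter.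
      have hmem := step (φ * partialConj (H := fun _ : Fin (n + 1) => Multiplicative (ZMod 2)) i
        (i := j) (Multiplicative.ofAdd 1)) i (g j ++ m) hi (by rw [← hm]; simp) (by
          rw [MulAut.mul_apply, partialConj_x, if_pos rfl, map_mul, map_mul, hg i, hg j, ← hm]
          simp only [wordProd_append, wordProd_cons, wordProd_nil, mul_one, mul_inv_rev]
          have h1 : ∀ y, x j * (x j * y) = y := fun y => by
            rw [← mul_assoc, x_mul_self, one_mul]
          simp [mul_assoc, x_inv, h1]) (by
          intro k hk
          rw [MulAut.mul_apply, partialConj_x, if_neg hk])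
      exact (Subgroup.mul_mem_cancel_right T hα).1 hmem
  · push Not at hred
    obtain ⟨i, hi⟩ := hred
    obtain ⟨m, hm, e⟩ := exists_shorter_conjugator hi
    refine step φ i m ?_ hm (by rw [hg, e]) fun _ _ => rfl
    rintro rfl
    rw [h0] at hm
    simp at hm

/-- Of membership in the Fouxe-Rabinovitch group, the reduction uses only this consequence. -/
theorem isConj_of_mem_fouxeRabinovitch {φ : MulAut (FreeProdZ2 n)}
    (hφ : φ ∈ fouxeRabinovitch (fun _ : Fin (n + 1) => Multiplicative (ZMod 2)))
    (i : Fin (n + 1)) : IsConj (x i) (φ (x i)) := by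
  induction hφ using Subgroup.closure_induction with
  | mem φ h =>
    obtain ⟨j, k, z, _, hz, rfl⟩ := h
    obtain rfl := (eq_one_or_eq_ofAdd_one z).resolve_left hz
    rw [partialConj_x]
    split_ifs
    · exact isConj_iff.2 ⟨x j, by rw [x_inv]⟩
    · exact IsConj.refl _
  | one => exact IsConj.refl _
  | mul φ ψ _ _ h1 h2 => exact h1.trans (φ.toMonoidHom.map_isConj h2)
  | inv φ _ h =>
    have := (φ⁻¹ : MulAut _).toMonoidHom.map_isConj h
    exact (by simpa using this : IsConj ((φ⁻¹ : MulAut _) (x i)) (x i)).symm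

theorem mem_of_mem_fouxeRabinovitchFix (T : Subgroup (MulAut (FreeProdZ2 n)))
    (hT : ∀ i j : Fin (n + 1), i ≠ 0 → i ≠ j →
      partialConj (H := fun _ : Fin (n + 1) => Multiplicative (ZMod 2)) i (i := j)
        (Multiplicative.ofAdd 1) ∈ T)
    {φ : MulAut (FreeProdZ2 n)} (hφ : φ ∈ fouxeRabinovitchFix n) : φ ∈ T := by
  have h : ∀ i, ∃ l, φ (x i) = wordProd l * x i * (wordProd l)⁻¹ := fun i => by
    obtain ⟨c, hc⟩ := isConj_iff.1 (isConj_of_mem_fouxeRabinovitch hφ.1 i)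
    exact ⟨normalForm c, by rw [wordProd_normalForm, hc]⟩
  choose g hg using h
  -- The conjugator chosen for `x 0` may be a nonempty word; as φ fixes `x 0`, the empty word
  -- serves.
  refine mem_of_conjugators T hT _ φ (Function.update g 0 []) (by simp) rfl fun i => ?_
  by_cases hi : i = 0
  · subst hi
    have h : φ (x 0) = x 0 := hφ.2
    simpa using h
  · rw [Function.update_of_ne hi, hg]

end Reduction


/-! ### The even subgroup is free -/

section Even

variable {n : ℕ}

/-- The homomorphism from the free group that sends the `i`-th generator to `x 0 * x i`. -/
def freeHom (n : ℕ) : FreeGroup (Fin n) →* FreeProdZ2 n :=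
  FreeGroup.lift fun i => x 0 * x i.succ

@[simp] theorem freeHom_of (i : Fin n) : freeHom n (FreeGroup.of i) = x 0 * x i.succ :=
  FreeGroup.lift_apply_of ..

/-- The endomorphism of a free group that inverts every generator. -/
def invGens (α : Type*) : FreeGroup α →* FreeGroup α :=
  FreeGroup.lift fun a => (FreeGroup.of a)⁻¹

@[simp] theorem invGens_of {α : Type*} (a : α) :
    invGens α (FreeGroup.of a) = (FreeGroup.of a)⁻¹ := FreeGroup.lift_apply_of ..

@[simp] theorem invGens_invGens {α : Type*} (w : FreeGroup α) :
    invGens α (invGens α w) = w := by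
  have : (invGens α).comp (invGens α) = MonoidHom.id _ :=
    FreeGroup.ext_hom _ _ fun a => by simp
  exact DFunLike.congr_fun this w

theorem invGens_eq_inv_rev {α : Type*} (w : FreeGroup α) :
    invGens α w = (rev w).unop⁻¹ := by
  have : (MulEquiv.inv' (FreeGroup α)).toMonoidHom.comp (invGens α) = rev := by
    refine FreeGroup.ext_hom _ _ fun a => ?_
    simp [rev]
  rw [← this]
  simp

/-- Inverting a word reverses it and inverts its letters, so inverting the letters alone gives the
inverse of the reversed word. -/
theorem isPalindrome_iff_invGens {α : Type*} [DecidableEq α] (w : FreeGroup α) :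
    IsPalindrome w ↔ invGens α w = w⁻¹ := by
  rw [isPalindrome_iff, invGens_eq_inv_rev, inv_inj]
  exact MulOpposite.unop_injective.eq_iff.symm

theorem x_mul_x_mul (i : Fin (n + 1)) (g : FreeProdZ2 n) : x i * (x i * g) = g := by
  rw [← mul_assoc, x_mul_self, one_mul]

theorem freeHom_invGens (w : FreeGroup (Fin n)) :
    freeHom n (invGens _ w) = x 0 * freeHom n w * x 0 := by
  have : (freeHom n).comp (invGens _) =
      (MulAut.conj (x 0)).toMonoidHom.comp (freeHom n) := by
    refine FreeGroup.ext_hom _ _ fun i => ?_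
    simp [x_inv, x_mul_x_mul]
  have := DFunLike.congr_fun this w
  simpa [x_inv] using this

/-- The involution by which a generator of the free product acts on the free group, viewed as
the set of cosets of the subgroup generated by `x 0`. -/
def cosetPerm (i : Fin (n + 1)) : Equiv.Perm (FreeGroup (Fin n)) :=
  -- The coset of x_i w is represented by the even element x_i w x_0 = (x_i x_0)(x_0 w x_0), where
  -- x_i x_0 is the inverse of x_0 x_i and conjugation by x_0 is `invGens`.
  let a : FreeGroup (Fin n) := Fin.cases 1 (fun j => (FreeGroup.of j)⁻¹) i
  have ha : invGens _ a = a⁻¹ := by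
    cases i using Fin.cases <;> simp [a]
  have h (w) : a * invGens _ (a * invGens _ w) = w := by simp [ha]
  ⟨fun w => a * invGens _ w, fun w => a * invGens _ w, h, h⟩

@[simp] theorem cosetPerm_zero (w : FreeGroup (Fin n)) : cosetPerm 0 w = invGens _ w :=
  one_mul _

@[simp] theorem cosetPerm_succ (i : Fin n) (w : FreeGroup (Fin n)) :
    cosetPerm i.succ w = (FreeGroup.of i)⁻¹ * invGens _ w := rfl

/-- The action of the free product on the free group. -/
def cosetAction (n : ℕ) : FreeProdZ2 n →* Equiv.Perm (FreeGroup (Fin n)) :=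
  liftInvolutions cosetPerm fun i => Equiv.ext (cosetPerm i).left_inv

/-- Even elements act by left translation, which is faithful; this gives injectivity of `freeHom`.
-/
theorem cosetAction_freeHom (w v : FreeGroup (Fin n)) :
    cosetAction n (freeHom n w) v = w * v := by
  have : (cosetAction n).comp (freeHom n) = MulAction.toPermHom (FreeGroup (Fin n)) _ := by
    refine FreeGroup.ext_hom _ _ fun i => Equiv.ext fun v => ?_
    simp [cosetAction, liftInvolutions_x]
  exact Equiv.congr_fun (DFunLike.congr_fun this w) v

theorem freeHom_injective (n : ℕ) : Function.Injective (freeHom n) := fun v w h => by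
  have := cosetAction_freeHom v 1
  rw [h, cosetAction_freeHom] at this
  simpa using this.symm

theorem x_zero_mul_x_mem_range (i : Fin (n + 1)) : x 0 * x i ∈ (freeHom n).range := by
  cases i using Fin.cases with
  | zero => exact ⟨1, by rw [map_one, x_mul_self]⟩
  | succ i => exact ⟨_, freeHom_of i⟩

theorem x_mul_x_mem_range (i j : Fin (n + 1)) : x i * x j ∈ (freeHom n).range := by
  have := mul_mem (inv_mem (x_zero_mul_x_mem_range i)) (x_zero_mul_x_mem_range j)
  simpa [x_inv, mul_assoc, x_mul_x_mul] using this

theorem mem_range_freeHom_of_even (l : List (Fin (n + 1))) (hl : Even l.length) :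
    wordProd l ∈ (freeHom n).range := by
  induction l using List.twoStepInduction with
  | nil => exact one_mem _
  | singleton i => simp at hl
  | cons_cons i j l ih _ =>
    rw [wordProd_cons, wordProd_cons, ← mul_assoc]
    refine mul_mem (x_mul_x_mem_range i j) (ih ?_)
    simpa [Nat.even_add_one] using hl

theorem range_freeHom (n : ℕ) : (freeHom n).range = evenSubgroup n := by
  apply le_antisymm
  · rw [freeHom, FreeGroup.range_lift_eq_closure, Subgroup.closure_le]
    rintro _ ⟨i, rfl⟩
    exact ⟨[0, i.succ], by simp, by simp⟩
  · rintro _ ⟨l, hl, rfl⟩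
    exact mem_range_freeHom_of_even l hl

/-- The isomorphism from the free group to the even subgroup. -/
noncomputable def freeEquivEven (n : ℕ) : FreeGroup (Fin n) ≃* evenSubgroup n :=
  (MonoidHom.ofInjective (freeHom_injective n)).trans
    (MulEquiv.subgroupCongr (range_freeHom n))

@[simp] theorem coe_freeEquivEven (w : FreeGroup (Fin n)) :
    (freeEquivEven n w : FreeProdZ2 n) = freeHom n w := rfl

/-! ### Automorphisms preserve the even subgroup -/

theorem x_ne_one (i : Fin (n + 1)) : (x i : FreeProdZ2 n) ≠ 1 := by
  intro h
  have := normalForm_wordProd (l := [i]) (by simp [Reduced])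
  rw [wordProd_cons, h] at this
  simp [normalForm] at this

theorem not_mem_even_of_mul_self {g : FreeProdZ2 n} (hg : g * g = 1) (h1 : g ≠ 1) :
    g ∉ evenSubgroup n := by
  rw [← range_freeHom]
  rintro ⟨w, rfl⟩
  rw [← map_mul, ← map_one (freeHom n)] at hg
  have h2 : w ^ 2 = 1 := by rw [sq]; exact freeHom_injective n hg
  rw [pow_eq_one_iff_left two_ne_zero] at h2
  exact h1 (by rw [h2, map_one])

theorem x_zero_mul_mem_even {g : FreeProdZ2 n} (hg : g ∉ evenSubgroup n) :
    x 0 * g ∈ evenSubgroup n := by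
  obtain ⟨l, rfl⟩ := exists_wordProd_eq g
  refine ⟨0 :: l, ?_, by simp [wordProd]⟩
  have : ¬ Even l.length := fun h => hg ⟨l, h, rfl⟩
  simpa [Nat.even_add_one] using this

/-- The image of x_0 x_i is x_0 φ(x_i), and φ(x_i) is an involution, hence not even. -/
theorem apply_freeHom_mem_even {φ : MulAut (FreeProdZ2 n)} (hφ : φ (x 0) = x 0)
    (w : FreeGroup (Fin n)) : φ (freeHom n w) ∈ evenSubgroup n := by
  have h : (φ.toMonoidHom.comp (freeHom n)).range ≤ evenSubgroup n := by
    have : φ.toMonoidHom.comp (freeHom n) =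
        FreeGroup.lift fun i => φ (x 0 * x i.succ) :=
      FreeGroup.ext_hom _ _ fun i => by simp
    rw [this, FreeGroup.range_lift_eq_closure, Subgroup.closure_le]
    rintro _ ⟨i, rfl⟩
    change φ (x 0 * x i.succ) ∈ evenSubgroup n
    rw [map_mul, hφ]
    refine x_zero_mul_mem_even (not_mem_even_of_mul_self ?_ ?_)
    · rw [← map_mul, x_mul_self, map_one]
    · exact (map_ne_one_iff φ φ.injective).2 (x_ne_one _)
  exact h ⟨w, rfl⟩

/-! ### The restriction homomorphism -/

/-- The restriction of an automorphism that fixes `x 0` to the free group. -/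
noncomputable def restrictFun (φ : autFix n) (w : FreeGroup (Fin n)) : FreeGroup (Fin n) :=
  (freeEquivEven n).symm ⟨φ.1 (freeHom n w), apply_freeHom_mem_even φ.2 w⟩

theorem freeHom_restrictFun (φ : autFix n) (w : FreeGroup (Fin n)) :
    freeHom n (restrictFun φ w) = φ.1 (freeHom n w) := by
  rw [← coe_freeEquivEven, restrictFun, MulEquiv.apply_symm_apply]

theorem restrictFun_mul (φ ψ : autFix n) (w : FreeGroup (Fin n)) :
    restrictFun (φ * ψ) w = restrictFun φ (restrictFun ψ w) :=
  freeHom_injective n (by simp only [freeHom_restrictFun]; rfl)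

theorem restrictFun_one (w : FreeGroup (Fin n)) : restrictFun (1 : autFix n) w = w :=
  freeHom_injective n (by simp only [freeHom_restrictFun]; rfl)

/-- Restriction of automorphisms that fix `x 0` to the free group. -/
noncomputable def restrict (n : ℕ) : autFix n →* MulAut (FreeGroup (Fin n)) where
  toFun φ :=
    { toFun := restrictFun φ
      invFun := restrictFun φ⁻¹
      left_inv w := by rw [← restrictFun_mul, inv_mul_cancel, restrictFun_one]
      right_inv w := by rw [← restrictFun_mul, mul_inv_cancel, restrictFun_one]
      map_mul' v w := freeHom_injective n (by simp only [freeHom_restrictFun, map_mul]) }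
  map_one' := MulEquiv.ext restrictFun_one
  map_mul' φ ψ := MulEquiv.ext (restrictFun_mul φ ψ)

theorem freeHom_restrict (φ : autFix n) (w : FreeGroup (Fin n)) :
    freeHom n (restrict n φ w) = φ.1 (freeHom n w) :=
  freeHom_restrictFun φ w

theorem mulAut_ext_of {α : Type*} {φ ψ : MulAut (FreeGroup α)}
    (h : ∀ a, φ (FreeGroup.of a) = ψ (FreeGroup.of a)) : φ = ψ :=
  MulEquiv.toMonoidHom_injective (FreeGroup.ext_hom _ _ h)

theorem restrict_eq_of {φ : autFix n} {ψ : MulAut (FreeGroup (Fin n))}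
    (h : ∀ i, φ.1 (x 0 * x (Fin.succ i)) = freeHom n (ψ (FreeGroup.of i))) :
    restrict n φ = ψ :=
  mulAut_ext_of fun i => freeHom_injective n (by rw [freeHom_restrict, freeHom_of, h])

theorem restrict_injective (n : ℕ) : Function.Injective (restrict n) := fun φ ψ h => by
  refine Subtype.ext (mulAut_ext_x fun i => ?_)
  have h0 : φ.1 (x 0) = x 0 := φ.2
  have h0' : ψ.1 (x 0) = x 0 := ψ.2
  cases i using Fin.cases with
  | zero => rw [h0, h0']
  | succ i =>
    have h1 := freeHom_restrict φ (FreeGroup.of i)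
    rw [h, freeHom_restrict, freeHom_of, map_mul, map_mul, h0, h0', mul_right_inj] at h1
    exact h1.symm

theorem restrict_mem_palindromicAut (φ : autFix n) :
    restrict n φ ∈ palindromicAut (Fin n) := fun i => by
  rw [isPalindrome_iff_invGens]
  have h0 : φ.1 (x 0) = x 0 := φ.2
  apply freeHom_injective n
  rw [freeHom_invGens, ← map_inv, freeHom_restrict, freeHom_restrict, ← invGens_of,
    freeHom_invGens, map_mul, map_mul, h0]

/-! ### Extension of palindromic automorphisms -/

theorem x_mul_freeHom_mul_self {w : FreeGroup (Fin n)} (hw : IsPalindrome w) :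
    (x 0 * freeHom n w) * (x 0 * freeHom n w) = 1 := by
  rw [← mul_assoc, ← freeHom_invGens, ← map_mul, (isPalindrome_iff_invGens w).1 hw,
    inv_mul_cancel, map_one]

/-- The extension to the free product of a palindromic automorphism of the free group. -/
def extendHom (ψ : palindromicAut (Fin n)) : FreeProdZ2 n →* FreeProdZ2 n :=
  liftInvolutions
    (Fin.cases (x 0) fun i => x 0 * freeHom n (ψ.1 (FreeGroup.of i)))
    (Fin.cases (x_mul_self 0) fun i => x_mul_freeHom_mul_self (ψ.2 i))

theorem extendHom_x_zero (ψ : palindromicAut (Fin n)) : extendHom ψ (x 0) = x 0 :=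
  liftInvolutions_x ..

theorem extendHom_x_succ (ψ : palindromicAut (Fin n)) (i : Fin n) :
    extendHom ψ (x i.succ) = x 0 * freeHom n (ψ.1 (FreeGroup.of i)) :=
  liftInvolutions_x ..

theorem extendHom_freeHom (ψ : palindromicAut (Fin n)) (w : FreeGroup (Fin n)) :
    extendHom ψ (freeHom n w) = freeHom n (ψ.1 w) := by
  have : (extendHom ψ).comp (freeHom n) = (freeHom n).comp ψ.1.toMonoidHom := by
    refine FreeGroup.ext_hom _ _ fun i => ?_
    simp [extendHom_x_zero, extendHom_x_succ, x_mul_x_mul]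
  exact DFunLike.congr_fun this w

theorem extendHom_comp (ψ χ : palindromicAut (Fin n)) (h : ψ * χ = 1) :
    (extendHom ψ).comp (extendHom χ) = MonoidHom.id _ := by
  refine hom_ext_x fun i => ?_
  cases i using Fin.cases with
  | zero => simp [extendHom_x_zero]
  | succ i =>
    have h1 : ψ.1 (χ.1 (FreeGroup.of i)) = FreeGroup.of i :=
      DFunLike.congr_fun (congrArg Subtype.val h) (FreeGroup.of i)
    rw [MonoidHom.comp_apply, extendHom_x_succ, map_mul, extendHom_x_zero, extendHom_freeHom, h1,
      freeHom_of, x_mul_x_mul]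
    rfl

/-- The automorphism of the free product that extends a palindromic automorphism of the free
group. -/
def extend (ψ : palindromicAut (Fin n)) : autFix n :=
  ⟨MonoidHom.toMulEquiv (extendHom ψ) (extendHom ψ⁻¹)
    (extendHom_comp _ _ (inv_mul_cancel ψ)) (extendHom_comp _ _ (mul_inv_cancel ψ)),
    extendHom_x_zero ψ⟩

theorem restrict_extend (ψ : palindromicAut (Fin n)) : restrict n (extend ψ) = ψ.1 :=
  MulEquiv.ext fun w => freeHom_injective n (by
    rw [freeHom_restrict, ← extendHom_freeHom]; rfl)

/-- Restriction is an isomorphism onto the palindromic automorphism group. -/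
noncomputable def restrictEquiv (n : ℕ) : autFix n ≃* palindromicAut (Fin n) :=
  MulEquiv.ofBijective ((restrict n).codRestrict _ restrict_mem_palindromicAut)
    ⟨fun _ _ h => restrict_injective n (congrArg Subtype.val h),
      fun ψ => ⟨extend ψ, Subtype.ext (restrict_extend ψ)⟩⟩

/-! ### The image of the Fouxe-Rabinovitch group -/

/-- The automorphism that conjugates the generator `x i`, `i ≠ 0`, by `x j`. -/
def partialConjFix (i j : Fin (n + 1)) (hi : i ≠ 0) : autFix n :=
  ⟨partialConj (H := fun _ : Fin (n + 1) => Multiplicative (ZMod 2)) i (i := j)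
    (Multiplicative.ofAdd 1), (partialConj_x i j 0).trans (if_neg hi.symm)⟩

theorem partialConjFix_x (i j k : Fin (n + 1)) (hi : i ≠ 0) :
    (partialConjFix i j hi).1 (x k) = if k = i then x j * x k * x j else x k :=
  partialConj_x i j k

theorem partialConjFix_x_zero (i j : Fin (n + 1)) (hi : i ≠ 0) :
    (partialConjFix i j hi).1 (x 0) = x 0 := (partialConjFix i j hi).2

theorem partialConjFix_mem (i j : Fin (n + 1)) (hi : i ≠ 0) (hij : i ≠ j) :
    partialConjFix i j hi ∈ (fouxeRabinovitchFix n).subgroupOf (autFix n) :=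
  ⟨Subgroup.subset_closure ⟨j, i, _, hij.symm, ofAdd_one_ne_one, rfl⟩, (partialConjFix i j hi).2⟩

theorem factorAut_apply {α : Type*} [DecidableEq α] (a : α) (w : FreeGroup α) :
    factorAut a w = replaceGen a (FreeGroup.of a)⁻¹ w := rfl

theorem whiteheadMove_apply {α : Type*} [DecidableEq α] (a b : α) (hab : a ≠ b)
    (w : FreeGroup α) : whiteheadMove a b hab w =
      replaceGen a (FreeGroup.of b * FreeGroup.of a * FreeGroup.of b) w := rfl

theorem restrict_partialConjFix_zero (i : Fin n) :
    restrict n (partialConjFix i.succ 0 (Fin.succ_ne_zero i)) = factorAut i := by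
  refine restrict_eq_of fun k => ?_
  rw [map_mul, partialConjFix_x_zero, partialConjFix_x]
  rw [factorAut_apply]
  by_cases hk : k = i
  · subst hk
    simp [replaceGen, x_inv, mul_assoc, x_mul_x_mul]
  · simp [replaceGen, hk]

theorem restrict_partialConjFix_succ (i j : Fin n) (hij : i ≠ j) :
    restrict n (partialConjFix i.succ j.succ (Fin.succ_ne_zero i)) =
      factorAut i * whiteheadMove i j hij := by
  refine restrict_eq_of fun k => ?_
  rw [map_mul, partialConjFix_x_zero, partialConjFix_x]
  rw [MulAut.mul_apply, factorAut_apply, whiteheadMove_apply]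
  by_cases hk : k = i
  · subst hk
    simp [replaceGen, x_inv, mul_assoc, x_mul_x_mul, hij.symm]
  · simp [replaceGen, hk]

theorem map_restrict_fouxeRabinovitchFix (n : ℕ) :
    ((fouxeRabinovitchFix n).subgroupOf (autFix n)).map (restrict n) =
      purePalindromicAut (Fin n) := by
  have hfac : ∀ i : Fin n, factorAut i ∈ purePalindromicAut (Fin n) := fun i =>
    Subgroup.subset_closure (Or.inr ⟨i, rfl⟩)
  apply le_antisymm
  · rintro _ ⟨φ, hφ, rfl⟩
    -- The reduction is applied to the subgroup of all automorphisms fixing `x 0` whose restriction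
    -- is pure palindromic.
    have hmem := mem_of_mem_fouxeRabinovitchFix
      (((purePalindromicAut (Fin n)).comap (restrict n)).map (autFix n).subtype) (by
        intro i j hi hij
        refine ⟨partialConjFix i j hi, ?_, rfl⟩
        change restrict n _ ∈ purePalindromicAut (Fin n)
        obtain ⟨i, rfl⟩ := Fin.exists_succ_eq.2 hi
        cases j using Fin.cases with
        | zero =>
          rw [restrict_partialConjFix_zero]
          exact hfac i
        | succ j =>
          have hij' : i ≠ j := fun h => hij (by rw [h])
          rw [restrict_partialConjFix_succ i j hij']
          exact mul_mem (hfac i) (Subgroup.subset_closure (Or.inl ⟨i, j, hij', rfl⟩))) hφ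
    obtain ⟨ψ, hψ, e⟩ := hmem
    obtain rfl : ψ = φ := Subtype.ext e
    exact hψ
  · have hfac' : ∀ i : Fin n, factorAut i ∈
        ((fouxeRabinovitchFix n).subgroupOf (autFix n)).map (restrict n) := fun i =>
      ⟨_, partialConjFix_mem _ _ _ (Fin.succ_ne_zero i), restrict_partialConjFix_zero i⟩
    rw [purePalindromicAut, Subgroup.closure_le]
    rintro _ (⟨i, j, hij, rfl⟩ | ⟨i, rfl⟩)
    -- A Whitehead move is reached only up to a factor automorphism, which is already in the image.
    · refine (Subgroup.mul_mem_cancel_left _ (hfac' i)).1 ?_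
      rw [← restrict_partialConjFix_succ]
      exact ⟨_, partialConjFix_mem _ _ _ (fun h => hij (Fin.succ_injective _ h)), rfl⟩
    · exact hfac' i

end Even

end PalindromicAut

theorem mainTheorem8 (n : ℕ) :
    -- the even-length subgroup is free on the elements `x_0 x_i`, `1 ≤ i ≤ n`
    ∃ e : FreeGroup (Fin n) ≃* PalindromicAut.evenSubgroup n,
      (∀ i : Fin n, (e (FreeGroup.of i) : PalindromicAut.FreeProdZ2 n) =
        PalindromicAut.x 0 * PalindromicAut.x i.succ) ∧
      ∃ ι : PalindromicAut.autFix n ≃* PalindromicAut.palindromicAut (Fin n),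
        -- `ι φ` is the restriction of `φ` to the even-length subgroup
        (∀ (φ : PalindromicAut.autFix n) (w : FreeGroup (Fin n)),
          (e ((ι φ : MulAut (FreeGroup (Fin n))) w) : PalindromicAut.FreeProdZ2 n) =
            (φ : MulAut (PalindromicAut.FreeProdZ2 n)) (e w)) ∧
        ((PalindromicAut.fouxeRabinovitchFix n).subgroupOf (PalindromicAut.autFix n)).map
            ((PalindromicAut.palindromicAut (Fin n)).subtype.comp ι.toMonoidHom) =
          PalindromicAut.purePalindromicAut (Fin n) :=
  ⟨PalindromicAut.freeEquivEven n, PalindromicAut.freeHom_of, PalindromicAut.restrictEquiv n,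
    PalindromicAut.freeHom_restrict, PalindromicAut.map_restrict_fouxeRabinovitchFix n⟩
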